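/- Conventions. A homomorphism of groups $n\colon M\to G$ is a *normal map* if it carries a crossed module structure, i.e. there is an action of $G$ on $M$ by automorphisms with $n(g\cdot m)=g\,n(m)\,g^{-1}$ and $n(m)\cdot m'=m\,m'\,m^{-1}$ for all $g\in G$, $m,m'\in M$. A *subnormal map* is a homomorphism that is a composite of a finite series of normal maps. The *free normal closure* of a homomorphism $\varphi\colon\Gamma\to G$ is the universal factorization $\Gamma\to\Gamma^{\varphi}\to G$ of $\varphi$ through a crossed module over $G$; explicitly, $\Gamma^{\varphi}$ is the quotient of the free product of copies ${}^{g}\Gamma$ of $\Gamma$ indexed by $g\in G$, mapped to $G$ by $\partial({}^{g}\gamma)=g\varphi(\gamma)g^{-1}$ and acted on by $h\cdot{}^{g}\gamma={}^{hg}\gamma$, by the normal closure of all elements $x\,y\,x^{-1}(\partial x\cdot y)^{-1}$, with $\Gamma\to\Gamma^{\varphi}$ given by $\gamma\mapsto{}^{1}\gamma$. The *normal closures tower* of $\varphi$ is defined by $\Gamma_1=G$, $\varphi_1=\varphi$, $\Gamma_{i+1}=\Gamma_i^{\varphi_i}$, with $\varphi_{i+1}\colon\Gamma\to\Gamma_{i+1}$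 and $\Gamma_{i+1}\to\Gamma_i$ the canonical maps. Let $\Gamma_{\infty,\varphi}=\varprojlim_i\Gamma_i$, let $\varphi_\infty\colon\Gamma\to\Gamma_{\infty,\varphi}$ be the map induced by the $\varphi_i$, and let $l\colon\Gamma_{\infty,\varphi}\to\Gamma_1=G$ be the projection. **Theorem.** Let $\varphi\colon\Gamma\to G$ be a homomorphism of finite groups. Then $\Gamma\xrightarrow{\varphi_\infty}\Gamma_{\infty,\varphi}\xrightarrow{l}G$ is the initial factorization of $\varphi$ among all factorizations of $\varphi$ whose second map is subnormal. That is, $l\circ\varphi_\infty=\varphi$, the map $l$ is subnormal, and for every group $S$ (finite or not) and all homomorphisms $\psi\colon\Gamma\to S$ and $s\colon S\to G$ with $s\circ\psi=\varphi$ and $s$ subnormal, there is exactly one homomorphism $\sigma\colon\Gamma_{\infty,\varphi}\to S$ with $\sigma\circ\varphi_\infty=\psi$ and $s\circ\sigma=l$. -/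

import Mathlib

universe u

/-- A normal structure on `n : M →* G`, i.e. a crossed module structure: an action of `G` on `M` by
group automorphisms with `n (g • m) = g * n m * g⁻¹` and `n m • m' = m * m' * m⁻¹`. -/
structure NormalStructure {M G : Type u} [Group M] [Group G] (n : M →* G) where
  /-- the action of `G` on `M` -/
  act : G →* MulAut M
  equivariant : ∀ (g : G) (m : M), n (act g m) = g * n m * g⁻¹
  peiffer : ∀ m m' : M, act (n m) m' = m * m' * m⁻¹

/-- A homomorphism is a normal map if it carries a crossed module structure. -/
def IsNormalMap {M G : Type u} [Group M] [Group G] (n : M →* G) : Prop :=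
  Nonempty (NormalStructure n)

/-- A homomorphism to `G` is a subnormal map if it is the composite of a finite series
`M_{k+1} → M_k → ⋯ → M_2 → M_1 = G` of normal maps. (The empty series gives the identity of `G`,
which is itself a normal map.) -/
inductive IsSubnormalMap {G : Type u} [Group G] :
    ∀ {M : Type u} [Group M], (M →* G) → Prop
  | id : IsSubnormalMap (MonoidHom.id G)
  | comp {M N : Type u} [Group M] [Group N] (m : M →* G) (n : N →* M) :
      IsSubnormalMap m → IsNormalMap n → IsSubnormalMap (m.comp n)

namespace FreeNormalClosure

section

variable {Γ G : Type u} [Group Γ] [Group G] (φ : Γ →* G)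

variable (Γ G) in
/-- The free product of copies of `Γ` indexed by the elements of `G`; the copy of `γ` with index
`g` stands for the formal conjugate `g γ g⁻¹`. -/
abbrev Pre : Type u := Monoid.CoprodI (fun _ : G => Γ)

/-- The formal conjugate of `γ` by `g`. -/
def formalConj (g : G) : Γ →* Pre Γ G := Monoid.CoprodI.of (M := fun _ : G => Γ) (i := g)

/-- The action of `h : G` on the free product: it permutes the copies of `Γ` by `g ↦ h * g`. -/
def translate (h : G) : Pre Γ G →* Pre Γ G :=
  Monoid.CoprodI.lift (fun g : G => formalConj (h * g))

/-- The homomorphism to `G` that sends the formal conjugate of `γ` by `g` to `g * φ γ * g⁻¹`. -/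
def preBoundary : Pre Γ G →* G :=
  Monoid.CoprodI.lift (fun g : G => (MulAut.conj g).toMonoidHom.comp φ)

/-- The Peiffer elements `x * y * x⁻¹ * (∂x • y)⁻¹`. -/
def peifferSet : Set (Pre Γ G) :=
  {z | ∃ x y : Pre Γ G, z = x * y * x⁻¹ * (translate (preBoundary φ x) y)⁻¹}

theorem preBoundary_translate (h : G) (y : Pre Γ G) :
    preBoundary φ (translate h y) = h * preBoundary φ y * h⁻¹ := by
  have key : (preBoundary φ).comp (translate h) =
      (MulAut.conj h).toMonoidHom.comp (preBoundary φ) := by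
    refine Monoid.CoprodI.ext_hom _ _ (fun g => ?_)
    ext γ
    simp [preBoundary, translate, formalConj, mul_assoc]
  simpa using DFunLike.congr_fun key y

end

end FreeNormalClosure

open FreeNormalClosure in
/-- The free normal closure `Γ^φ` of `φ : Γ →* G`: the quotient of the free product of the formal
conjugates of `Γ` by the Peiffer relations. -/
def FreeNormalClosure {Γ G : Type u} [Group Γ] [Group G] (φ : Γ →* G) : Type u :=
  Pre Γ G ⧸ Subgroup.normalClosure (peifferSet φ)

namespace FreeNormalClosure

section

variable {Γ G : Type u} [Group Γ] [Group G] (φ : Γ →* G)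

instance : Group (FreeNormalClosure φ) :=
  inferInstanceAs (Group (Pre Γ G ⧸ Subgroup.normalClosure (peifferSet φ)))

/-- The canonical homomorphism `c_φ : Γ →* Γ^φ`. -/
def unit : Γ →* FreeNormalClosure φ :=
  (QuotientGroup.mk' (Subgroup.normalClosure (peifferSet φ))).comp (formalConj 1)

theorem normalClosure_le_ker :
    Subgroup.normalClosure (peifferSet φ) ≤ (preBoundary φ).ker := by
  refine Subgroup.normalClosure_le_normal ?_
  rintro _ ⟨x, y, rfl⟩
  simp [MonoidHom.mem_ker, preBoundary_translate, mul_assoc]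

/-- The canonical homomorphism `Γ^φ →* G`; its composite with `c_φ` is `φ`. -/
def boundary : FreeNormalClosure φ →* G :=
  QuotientGroup.lift (Subgroup.normalClosure (peifferSet φ)) (preBoundary φ)
    (fun _ hx => normalClosure_le_ker φ hx)

theorem boundary_unit (γ : Γ) : boundary φ (unit φ γ) = φ γ := by
  change preBoundary φ (formalConj 1 γ) = φ γ
  simp [preBoundary, formalConj]

end

end FreeNormalClosure

/-- A group together with a homomorphism from `Γ`. -/
structure GroupUnder (Γ : Type u) [Group Γ] where
  /-- the group -/
  carrier : Type u
  /-- its group structure -/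
  [group : Group carrier]
  /-- the homomorphism from `Γ` -/
  hom : Γ →* carrier

attribute [instance] GroupUnder.group

namespace NormalClosuresTower

section

variable {Γ G : Type u} [Group Γ] [Group G] (φ : Γ →* G)

/-- The normal closures tower of `φ`, with indices starting at `0`: `stage φ 0` is `φ : Γ →* G`,
and `stage φ (i + 1)` is the free normal closure of `stage φ i` with its canonical homomorphism
from `Γ`. -/
def stage : ℕ → GroupUnder Γ
  | 0 => ⟨G, φ⟩
  | i + 1 => ⟨FreeNormalClosure (stage i).hom, FreeNormalClosure.unit (stage i).hom⟩

/-- The normal map from each stage of the tower to the preceding one. -/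
def down (i : ℕ) : (stage φ (i + 1)).carrier →* (stage φ i).carrier :=
  FreeNormalClosure.boundary (stage φ i).hom

/-- The inverse limit `Γ_∞` of the tower, as a group of compatible sequences. -/
def limit : Subgroup (∀ i, (stage φ i).carrier) where
  carrier := {x | ∀ i, down φ i (x (i + 1)) = x i}
  one_mem' i := map_one _
  mul_mem' {x y} hx hy i := by
    rw [Pi.mul_apply, Pi.mul_apply, map_mul, hx i, hy i]
  inv_mem' {x} hx i := by
    rw [Pi.inv_apply, Pi.inv_apply, map_inv, hx i]

/-- The natural homomorphism `φ_∞ : Γ →* Γ_∞`. -/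
def toLimit : Γ →* limit φ :=
  (MonoidHom.pi (fun i => (stage φ i).hom)).codRestrict (limit φ)
    (fun γ i => FreeNormalClosure.boundary_unit (stage φ i).hom γ)

/-- The natural homomorphism `Γ_∞ →* G`, the projection to the bottom of the tower. -/
def fromLimit : limit φ →* G :=
  (Pi.evalMonoidHom (fun i => (stage φ i).carrier) 0).comp (limit φ).subtype

end

end NormalClosuresTower

/-!
Write `D` for the limit and `K i` for the kernel of its projection to the stage `i` of the tower.
The maps of the tower have central kernels, so `⁅K i, D⁆ ≤ K (i + 1)`, and `K 0 / K i` consists of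
hypercentral elements of `Q = D / K i`. The stages are finite, so `Q` is a stable image in the
stage `i`, and a stable image is generated by its conjugates of the image `H` of `Γ`.

The order of `Q` is bounded independently of `i`. A subnormal subgroup whose normal closure is `Q`
equals `Q`. Applied to the product of `H` with a term of the lower central series, this bounds the
index of the nilpotent residual `L = ⁅L, Q⁆` by the order of `Γ`; applied to a subgroup that
generates `Q` modulo the hypercentre, it bounds the rank of `Q`. By the three subgroups lemma `L`
commutes with the hypercentre, of index `m` say. By transfer, `x ↦ x ^ m` is then a homomorphism
from `L` to the hypercentre, and it is trivial because its image `P` satisfies `P = ⁅P, Q⁆`. Hence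
the intersection of `L` with the hypercentre is abelian of bounded rank and exponent.

So some `K i` is trivial, and `D → G` is a chain of central extensions of a subnormal subgroup.
Conversely, each stage of the tower maps to a given subnormal factorization by the universal
property of the free normal closure. Two such maps from `D` differ, one crossed module at a time,
by central elements, so they agree on a normal subgroup; it contains the image of `Γ`, whose normal
closure is `D`.
-/

section GroupTheory

open Subgroup

variable {A B : Type*} [Group A] [Group B]

theorem exists_forall_le_of_index_le {K : ℕ → Subgroup A} (hK : Antitone K)
    [∀ i, (K i).FiniteIndex] {b : ℕ} (hb : ∀ i, (K i).index ≤ b) : ∃ n, ∀ i, K n ≤ K i := by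
  have hmono : Monotone fun i => (K i).index := fun i j hij =>
    Nat.le_of_dvd (Nat.pos_of_ne_zero FiniteIndex.index_ne_zero) (index_dvd_of_le (hK hij))
  obtain ⟨c, n, hn⟩ := converges_of_monotone_of_bounded hmono hb
  refine ⟨n, fun i => ?_⟩
  rcases le_total i n with hin | hni
  · exact hK hin
  · have hrel := relIndex_mul_index (hK hni)
    rw [hn i hni, hn n le_rfl, ← hn n le_rfl] at hrel
    exact relIndex_eq_one.1 (Nat.eq_of_mul_eq_mul_right
      (Nat.pos_of_ne_zero FiniteIndex.index_ne_zero) (hrel.trans (one_mul _).symm))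

theorem isSubnormal_sup_of_commutator_top_le {H K M : Subgroup A} (hKM : K ≤ M)
    (hMK : ⁅M, (⊤ : Subgroup A)⁆ ≤ K) (hM : (H ⊔ M).IsSubnormal) : (H ⊔ K).IsSubnormal := by
  refine .step _ _ (sup_le_sup_left hKM H) hM ?_
  rw [normal_subgroupOf_iff_le_normalizer (sup_le_sup_left hKM H)]
  refine sup_le (le_sup_left.trans le_normalizer) (le_normalizer_iff_commutator_le_right.2 ?_)
  exact ((commutator_mono le_rfl le_top).trans hMK).trans le_sup_right

theorem isSubnormal_sup_lowerCentralSeries (H : Subgroup A) (n : ℕ) :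
    (H ⊔ (⊤ : Subgroup A).lowerCentralSeries n).IsSubnormal := by
  induction n with
  | zero => simp
  | succ n ih =>
    exact isSubnormal_sup_of_commutator_top_le
      (Subgroup.lowerCentralSeries_antitone _ n.le_succ) le_rfl ih

theorem isSubnormal_of_sup_upperCentralSeries {H : Subgroup A} {k : ℕ}
    (hk : (H ⊔ Subgroup.upperCentralSeries A k).IsSubnormal) : H.IsSubnormal := by
  induction k with
  | zero => simpa using hk
  | succ k ih =>
    exact ih (isSubnormal_sup_of_commutator_top_le
      (Subgroup.upperCentralSeries_mono A k.le_succ)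
      (Subgroup.commutator_upperCentralSeries_top_le A k) hk)

theorem eq_top_of_isSubnormal_of_normalClosure_eq_top {H : Subgroup A} (hH : H.IsSubnormal)
    (hA : normalClosure (H : Set A) = ⊤) : H = ⊤ := by
  refine hH.lt_normal.resolve_right ?_
  rintro ⟨K, hK, hHK, hKtop⟩
  exact hKtop.not_ge (hA ▸ normalClosure_le_normal hHK)

theorem commutator_commutator_le_of_rotate {H₁ H₂ H₃ N : Subgroup A} [N.Normal]
    (h₁ : ⁅⁅H₂, H₃⁆, H₁⁆ ≤ N) (h₂ : ⁅⁅H₃, H₁⁆, H₂⁆ ≤ N) : ⁅⁅H₁, H₂⁆, H₃⁆ ≤ N := by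
  rw [← QuotientGroup.ker_mk' N, ← Subgroup.map_eq_bot_iff] at h₁ h₂ ⊢
  simp only [map_commutator] at h₁ h₂ ⊢
  exact commutator_commutator_eq_bot_of_rotate h₁ h₂

theorem eq_bot_of_le_commutator_top_of_le_upperCentralSeries {M : Subgroup A}
    (hM : M ≤ ⁅M, (⊤ : Subgroup A)⁆) {k : ℕ} (hk : M ≤ Subgroup.upperCentralSeries A k) :
    M = ⊥ := by
  induction k with
  | zero => simpa using hk
  | succ k ih =>
    exact ih (hM.trans ((commutator_mono hk le_rfl).trans
      (Subgroup.commutator_upperCentralSeries_top_le A k)))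

theorem commutator_upperCentralSeries_eq_bot {L : Subgroup A} [L.Normal]
    (hL : L ≤ ⁅L, (⊤ : Subgroup A)⁆) (k : ℕ) : ⁅L, Subgroup.upperCentralSeries A k⁆ = ⊥ := by
  induction k with
  | zero => simp
  | succ k ih =>
    set Z := Subgroup.upperCentralSeries A (k + 1)
    have hZ : ⁅L, Z⁆ ≤ ⁅⁅L, Z⁆, (⊤ : Subgroup A)⁆ := by
      refine (commutator_mono hL le_rfl).trans (commutator_commutator_le_of_rotate ?_ ?_)
      · rw [commutator_comm, commutator_comm ⊤ Z]
        exact (commutator_mono le_rfl (Subgroup.commutator_upperCentralSeries_top_le A k)).trans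
          (ih.trans_le bot_le)
      · rw [commutator_comm Z L]
    exact eq_bot_of_le_commutator_top_of_le_upperCentralSeries hZ (commutator_le_right L Z)

theorem mul_pow_of_index_center_dvd {m : ℕ} (hm : (center A).index ∣ m) (x y : A) :
    (x * y) ^ m = x ^ m * y ^ m := by
  obtain ⟨d, rfl⟩ := hm
  rcases eq_or_ne (center A).index 0 with h0 | h0
  · simp [h0]
  have : (center A).FiniteIndex := ⟨h0⟩
  have hmul : (x * y) ^ (center A).index = x ^ (center A).index * y ^ (center A).index := by
    simp only [← MonoidHom.transferCenterPow_apply, map_mul, coe_mul]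
  have hcomm : Commute (x ^ (center A).index) (y ^ (center A).index) :=
    ((mem_center_iff.1 (pow_index_mem (center A) x)) _).symm
  rw [pow_mul, hmul, hcomm.mul_pow, ← pow_mul, ← pow_mul]

open scoped commutatorElement in
theorem commute_of_mem_upperCentralSeries {L : Subgroup A} [L.Normal]
    (hL : L ≤ ⁅L, (⊤ : Subgroup A)⁆) {k : ℕ} {x z : A} (hx : x ∈ L)
    (hz : z ∈ Subgroup.upperCentralSeries A k) : Commute x z := by
  rw [← commutatorElement_eq_one_iff_commute, ← mem_bot,
    ← commutator_upperCentralSeries_eq_bot hL k]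
  exact commutator_mem_commutator hx hz

theorem index_center_dvd_index_upperCentralSeries {L : Subgroup A} [L.Normal]
    (hL : L ≤ ⁅L, (⊤ : Subgroup A)⁆) (k : ℕ) :
    (center L).index ∣ (Subgroup.upperCentralSeries A k).index := by
  have hle : (Subgroup.upperCentralSeries A k).subgroupOf L ≤ center L := fun _ hz =>
    mem_center_iff.2 fun x => Subtype.ext (commute_of_mem_upperCentralSeries hL x.2 hz)
  exact (index_dvd_of_le hle).trans (relIndex_dvd_index_of_normal _ L)

open scoped commutatorElement in
theorem range_le_commutator_range_top {L : Subgroup A} [L.Normal]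
    (hL : L ≤ ⁅L, (⊤ : Subgroup A)⁆) (f : L →* A)
    (hf : ∀ (g : A) (x : L), f (MulAut.conjNormal g x) = g * f x * g⁻¹) :
    f.range ≤ ⁅f.range, (⊤ : Subgroup A)⁆ := by
  have hle : L ≤ (⁅f.range, (⊤ : Subgroup A)⁆.comap f).map L.subtype := by
    refine hL.trans (commutator_le.2 fun x hx g _ => ?_)
    refine ⟨⟨x, hx⟩ * (MulAut.conjNormal g ⟨x, hx⟩)⁻¹, ?_, ?_⟩
    · have hfx : f (⟨x, hx⟩ * (MulAut.conjNormal g ⟨x, hx⟩)⁻¹) = ⁅f ⟨x, hx⟩, g⁆ := by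
        rw [map_mul, map_inv, hf, commutatorElement_def]
        group
      exact mem_comap.2 (hfx ▸ commutator_mem_commutator ⟨_, rfl⟩ (mem_top g))
    · simp [commutatorElement_def, mul_assoc]
  rintro _ ⟨x, rfl⟩
  obtain ⟨y, hy, heq⟩ := hle x.2
  exact Subtype.ext heq ▸ hy

theorem pow_index_upperCentralSeries_eq_one {L : Subgroup A} [L.Normal]
    (hL : L ≤ ⁅L, (⊤ : Subgroup A)⁆) (k : ℕ) {x : A} (hx : x ∈ L) :
    x ^ (Subgroup.upperCentralSeries A k).index = 1 := by
  let power : L →* A :=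
    { toFun := fun y => (y : A) ^ (Subgroup.upperCentralSeries A k).index
      map_one' := by simp
      map_mul' := fun y z => congrArg L.subtype
        (mul_pow_of_index_center_dvd (index_center_dvd_index_upperCentralSeries hL k) y z) }
  have hrange : power.range ≤ ⁅power.range, (⊤ : Subgroup A)⁆ :=
    range_le_commutator_range_top hL power fun _ _ => conj_pow
  have hhyper : power.range ≤ Subgroup.upperCentralSeries A k := by
    rintro _ ⟨y, rfl⟩
    exact pow_index_mem _ _
  have hbot := eq_bot_of_le_commutator_top_of_le_upperCentralSeries hrange hhyper
  exact (eq_bot_iff_forall _).1 hbot _ ⟨⟨x, hx⟩, rfl⟩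

theorem index_lowerCentralSeries_le {H : Subgroup A} [Finite H]
    (hH : normalClosure (H : Set A) = ⊤) (n : ℕ) :
    ((⊤ : Subgroup A).lowerCentralSeries n).index ≤ Nat.card H := by
  set L := (⊤ : Subgroup A).lowerCentralSeries n
  have htop : H ⊔ L = ⊤ := by
    refine eq_top_of_isSubnormal_of_normalClosure_eq_top
      (isSubnormal_sup_lowerCentralSeries H n) (top_le_iff.1 ?_)
    exact hH.ge.trans (normalClosure_mono (SetLike.coe_subset_coe.2 le_sup_left))
  rw [← relIndex_top_right, ← htop, relIndex_sup_right]
  exact Nat.le_of_dvd Nat.card_pos (relIndex_dvd_card L H)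

theorem rank_le_of_normalClosure_eq_top [Group.FG A] {H : Subgroup A} [Finite H]
    (hH : normalClosure (H : Set A) = ⊤) (k : ℕ) [(Subgroup.upperCentralSeries A k).FiniteIndex] :
    Group.rank A ≤ Nat.card H + (Subgroup.upperCentralSeries A k).index := by
  classical
  set Z := Subgroup.upperCentralSeries A k
  set reps : Set A := Set.range (Quotient.out : A ⧸ Z → A)
  have hsup : closure ((H : Set A) ∪ reps) ⊔ Z = ⊤ := by
    refine top_le_iff.1 fun a _ => ?_
    obtain ⟨z, hz⟩ := QuotientGroup.mk_out_eq_mul Z a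
    have hout : (a : A ⧸ Z).out ∈ closure ((H : Set A) ∪ reps) :=
      subset_closure (Or.inr ⟨_, rfl⟩)
    rw [eq_mul_inv_of_mul_eq hz.symm]
    exact mul_mem (mem_sup_left hout) (mem_sup_right (inv_mem z.2))
  have htop : closure ((H : Set A) ∪ reps) = ⊤ := by
    refine eq_top_of_isSubnormal_of_normalClosure_eq_top
      (isSubnormal_of_sup_upperCentralSeries (hsup ▸ IsSubnormal.top)) (top_le_iff.1 ?_)
    exact hH.ge.trans (normalClosure_mono (Set.subset_union_left.trans subset_closure))
  have : Finite (A ⧸ Z) := finite_quotient_of_finiteIndex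
  have hfin : ((H : Set A) ∪ reps).Finite :=
    (Set.toFinite (H : Set A)).union (Set.finite_range _)
  calc Group.rank A ≤ hfin.toFinset.card := Group.rank_le (by rw [hfin.coe_toFinset, htop])
    _ = ((H : Set A) ∪ reps).ncard := (Set.ncard_eq_toFinset_card _ hfin).symm
    _ ≤ (H : Set A).ncard + reps.ncard := Set.ncard_union_le _ _
    _ ≤ Nat.card H + Z.index := by
      gcongr
      · rfl
      · exact Finite.card_range_le (Quotient.out : A ⧸ Z → A)

open scoped IsMulCommutative in
theorem card_le_of_normalClosure_eq_top [Finite A] {H : Subgroup A}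
    (hH : normalClosure (H : Set A) = ⊤) {k m : ℕ}
    (hm : (Subgroup.upperCentralSeries A k).index ≤ m) :
    Nat.card A ≤ Nat.card H * m * m ^ (Nat.card H * m * (Nat.card H + m)) := by
  obtain ⟨n, hn⟩ := exists_forall_le_of_index_le
    ((⊤ : Subgroup A).lowerCentralSeries_antitone) (index_lowerCentralSeries_le hH)
  set Z := Subgroup.upperCentralSeries A k
  set L := (⊤ : Subgroup A).lowerCentralSeries n
  have hL : L ≤ ⁅L, (⊤ : Subgroup A)⁆ := hn (n + 1)
  have : IsMulCommutative ↥(L ⊓ Z) :=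
    ⟨⟨fun x y => Subtype.ext (commute_of_mem_upperCentralSeries hL x.2.1 y.2.2)⟩⟩
  have hindex : (L ⊓ Z).index ≤ Nat.card H * m :=
    index_inf_le.trans (Nat.mul_le_mul (index_lowerCentralSeries_le hH n) hm)
  have hexp : ∀ x : ↥(L ⊓ Z), x ^ Z.index = 1 := fun x =>
    Subtype.ext (pow_index_upperCentralSeries_eq_one hL k x.2.1)
  have hpos : 0 < Z.index := Nat.pos_of_ne_zero FiniteIndex.index_ne_zero
  have hrank : Group.rank ↥(L ⊓ Z) ≤ Nat.card H * m * (Nat.card H + m) :=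
    (rank_le_index_mul_rank (L ⊓ Z)).trans (Nat.mul_le_mul hindex
      ((rank_le_of_normalClosure_eq_top hH k).trans (Nat.add_le_add_left hm _)))
  calc Nat.card A = (L ⊓ Z).index * Nat.card ↥(L ⊓ Z) := (index_mul_card _).symm
    _ ≤ (L ⊓ Z).index * Z.index ^ Group.rank ↥(L ⊓ Z) := by
      gcongr
      exact Nat.le_of_dvd (pow_pos hpos _) (card_dvd_exponent_pow_rank' _ hexp)
    _ ≤ _ := Nat.mul_le_mul hindex
      ((Nat.pow_le_pow_right hpos hrank).trans (Nat.pow_le_pow_left hm _))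

open scoped IsMulCommutative in
theorem finite_of_finiteIndex_center [(center A).FiniteIndex] {S : Set A} (hS : S.Finite)
    (hA : closure S = ⊤) (hord : ∀ x ∈ S, IsOfFinOrder x) : Finite A := by
  have : Group.FG A := ⟨⟨hS.toFinset, by simpa using hA⟩⟩
  have htorsion : closure S ≤
      (CommGroup.torsion (center A)).comap (MonoidHom.transferCenterPow A) :=
    (closure_le _).2 fun x hx => (MonoidHom.transferCenterPow A).isOfFinOrder (hord x hx)
  have hcenter : IsMulTorsion (center A) := fun z =>
    have hz := htorsion (hA ▸ mem_top (z : A))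
    (center A).subtype_injective.isOfFinOrder_iff.1
      (((center A).subtype.isOfFinOrder hz).of_pow FiniteIndex.index_ne_zero)
  have : Finite (center A) := CommGroup.finite_of_fg_isMulTorsion _ hcenter
  exact Finite.of_subgroup_quotient (center A)

theorem map_filtration_le_upperCentralSeries {K : ℕ → Subgroup A}
    (hK : ∀ i, ⁅K i, (⊤ : Subgroup A)⁆ ≤ K (i + 1)) {f : A →* B} (hf : Function.Surjective f)
    {n : ℕ} (hn : K n ≤ f.ker) : (K 0).map f ≤ Subgroup.upperCentralSeries B n := by
  induction n generalizing K with
  | zero => exact ((Subgroup.map_eq_bot_iff _).2 hn).trans_le bot_le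
  | succ n ih =>
    have hcomm : ⁅(K 0).map f, (⊤ : Subgroup B)⁆ ≤ Subgroup.upperCentralSeries B n := by
      rw [← map_top_of_surjective f hf, ← map_commutator]
      exact (map_mono (hK 0)).trans (ih (fun i => hK (i + 1)) hn)
    exact fun x hx => Subgroup.mem_upperCentralSeries_succ_iff.2 fun y =>
      hcomm (commutator_mem_commutator hx (mem_top y))

theorem exists_forall_le_of_normalClosure_sup_eq_top {K : ℕ → Subgroup A} [∀ i, (K i).Normal]
    [∀ i, (K i).FiniteIndex] (hK : Antitone K) (hcomm : ∀ i, ⁅K i, (⊤ : Subgroup A)⁆ ≤ K (i + 1))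
    {H : Subgroup A} [Finite H] (hH : ∀ i, normalClosure (H : Set A) ⊔ K i = ⊤) :
    ∃ n, ∀ i, K n ≤ K i := by
  have hpos : 1 ≤ (K 0).index := Nat.pos_of_ne_zero FiniteIndex.index_ne_zero
  refine exists_forall_le_of_index_le hK (b := Nat.card H * (K 0).index *
    (K 0).index ^ (Nat.card H * (K 0).index * (Nat.card H + (K 0).index))) fun i => ?_
  set π := QuotientGroup.mk' (K i)
  have hπ : Function.Surjective π := QuotientGroup.mk'_surjective (K i)
  have htop : normalClosure ((H.map π : Subgroup _) : Set (A ⧸ K i)) = ⊤ := by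
    rw [coe_map, ← map_normalClosure _ π hπ, ← map_top_of_surjective π hπ, ← hH i,
      Subgroup.map_sup, (Subgroup.map_eq_bot_iff (K i)).2 (QuotientGroup.ker_mk' _).ge, sup_bot_eq]
  have hindex : (Subgroup.upperCentralSeries (A ⧸ K i) i).index ≤ (K 0).index :=
    (index_antitone (map_filtration_le_upperCentralSeries hcomm hπ
      (QuotientGroup.ker_mk' (K i)).ge)).trans
      (Nat.le_of_dvd hpos (index_map_dvd (K 0) hπ))
  have hcard : Nat.card (H.map π) ≤ Nat.card H := Nat.le_of_dvd Nat.card_pos (card_map_dvd H π)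
  calc (K i).index = Nat.card (A ⧸ K i) := index_eq_card _
    _ ≤ _ := card_le_of_normalClosure_eq_top htop hindex
    _ ≤ _ := by gcongr

/-- The subgroup generated by the conjugates of the elements of `X` by the elements of `H`: a
relative version of the normal closure, for `X` not necessarily contained in `H`. -/
def conjClosure (H : Subgroup A) (X : Set A) : Subgroup A :=
  closure (Set.image2 (fun a x => a * x * a⁻¹) H X)

theorem map_conjClosure (f : A →* B) (H : Subgroup A) (X : Set A) :
    (conjClosure H X).map f = conjClosure (H.map f) (f '' X) := by
  rw [conjClosure, conjClosure, MonoidHom.map_closure, coe_map, Set.image_image2_distrib]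
  simp

theorem le_normalizer_conjClosure (H : Subgroup A) (X : Set A) :
    H ≤ normalizer (conjClosure H X : Set A) := by
  refine le_normalizer_closure_iff.2 ?_
  rintro h hh _ ⟨a, ha, x, hx, rfl⟩
  exact subset_closure ⟨h * a, mul_mem hh ha, x, hx, by group⟩

theorem conjClosure_top (X : Set A) : conjClosure ⊤ X = normalClosure X := by
  refine le_antisymm ((closure_le _).2 ?_) ?_
  · rintro _ ⟨a, -, x, hx, rfl⟩
    exact normalClosure_normal.conj_mem x (subset_normalClosure hx) a
  · have : (conjClosure ⊤ X).Normal :=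
      normalizer_eq_top_iff.1 (top_le_iff.1 (le_normalizer_conjClosure ⊤ X))
    exact normalClosure_le_normal fun x hx => subset_closure ⟨1, trivial, x, hx, by simp⟩

end GroupTheory

namespace FreeNormalClosure

variable {Γ G : Type u} [Group Γ] [Group G] (φ : Γ →* G)

/-- The copy of `Γ` with index `g` in the free normal closure. -/
def copy (g : G) : Γ →* FreeNormalClosure φ :=
  (QuotientGroup.mk' (Subgroup.normalClosure (peifferSet φ))).comp (formalConj g)

theorem boundary_copy (g : G) (γ : Γ) : boundary φ (copy φ g γ) = g * φ γ * g⁻¹ := by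
  change preBoundary φ (formalConj g γ) = _
  simp [preBoundary, formalConj]

theorem closure_range_copy :
    Subgroup.closure (Set.range fun p : G × Γ => copy φ p.1 p.2) = ⊤ := by
  rw [eq_top_iff]
  intro x _
  obtain ⟨y, rfl⟩ := QuotientGroup.mk_surjective x
  induction y using Monoid.CoprodI.induction_on with
  | one => exact one_mem _
  | of g γ => exact Subgroup.subset_closure ⟨(g, γ), rfl⟩
  | mul x y hx hy => exact mul_mem (hx trivial) (hy trivial)

theorem translate_one (y : Pre Γ G) : translate 1 y = y := by
  have : translate (1 : G) = MonoidHom.id (Pre Γ G) := by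
    refine Monoid.CoprodI.ext_hom _ _ fun g => ?_
    ext γ
    simp [translate, formalConj]
  exact DFunLike.congr_fun this y

theorem ker_boundary_le_center : (boundary φ).ker ≤ Subgroup.center (FreeNormalClosure φ) := by
  intro x hx
  rw [Subgroup.mem_center_iff]
  intro y
  obtain ⟨x, rfl⟩ := QuotientGroup.mk_surjective x
  obtain ⟨y, rfl⟩ := QuotientGroup.mk_surjective y
  have hx : preBoundary φ x = 1 := hx
  refine QuotientGroup.eq.2 (Subgroup.subset_normalClosure ⟨x⁻¹, y⁻¹, ?_⟩)
  have hx : preBoundary φ x⁻¹ = 1 := by rw [map_inv, hx, inv_one]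
  rw [hx, translate_one]
  group

theorem range_boundary :
    (boundary φ).range = Subgroup.normalClosure (Set.range φ) := by
  rw [MonoidHom.range_eq_map, ← closure_range_copy, MonoidHom.map_closure, ← conjClosure_top,
    conjClosure]
  congr 1
  ext x
  simp [boundary_copy]

theorem finite [Finite Γ] [Finite G] : Finite (FreeNormalClosure φ) := by
  have : (Subgroup.center (FreeNormalClosure φ)).FiniteIndex :=
    Subgroup.finiteIndex_of_le (ker_boundary_le_center φ)
  refine finite_of_finiteIndex_center (Set.finite_range _) (closure_range_copy φ) ?_
  rintro _ ⟨⟨g, γ⟩, rfl⟩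
  exact MonoidHom.isOfFinOrder _ (isOfFinOrder_of_finite γ)

section Lift

variable {φ} {M N : Type u} [Group M] [Group N] {n : N →* M} (c : NormalStructure n)
  (τ : G →* M) (ψ : Γ →* N)

/-- The homomorphism from the free product that underlies `lift`. -/
def preLift : Pre Γ G →* N :=
  Monoid.CoprodI.lift fun g : G => (c.act (τ g)).toMonoidHom.comp ψ

theorem preLift_translate (h : G) (y : Pre Γ G) :
    preLift c τ ψ (translate h y) = c.act (τ h) (preLift c τ ψ y) := by
  have : (preLift c τ ψ).comp (translate h) =
      (c.act (τ h)).toMonoidHom.comp (preLift c τ ψ) := by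
    refine Monoid.CoprodI.ext_hom _ _ fun g => ?_
    ext γ
    simp [preLift, translate, formalConj]
  exact DFunLike.congr_fun this y

theorem apply_preLift (h : n.comp ψ = τ.comp φ) (x : Pre Γ G) :
    n (preLift c τ ψ x) = τ (preBoundary φ x) := by
  have : n.comp (preLift c τ ψ) = τ.comp (preBoundary φ) := by
    refine Monoid.CoprodI.ext_hom _ _ fun g => ?_
    ext γ
    have := DFunLike.congr_fun h γ
    simp only [MonoidHom.comp_apply] at this
    simp [preLift, preBoundary, c.equivariant, this]
  exact DFunLike.congr_fun this x

/-- The homomorphism from the free normal closure of `φ` to a crossed module `n : N →* M` induced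
by a commutative square from `φ` to `n`. -/
def lift (h : n.comp ψ = τ.comp φ) : FreeNormalClosure φ →* N :=
  QuotientGroup.lift (Subgroup.normalClosure (peifferSet φ)) (preLift c τ ψ) <| by
    intro x hx
    refine Subgroup.normalClosure_le_normal (N := (preLift c τ ψ).ker) ?_ hx
    rintro _ ⟨x, y, rfl⟩
    change preLift c τ ψ _ = 1
    rw [map_mul, map_inv, preLift_translate, ← apply_preLift c τ ψ h, c.peiffer]
    simp

theorem lift_unit (h : n.comp ψ = τ.comp φ) (γ : Γ) : lift c τ ψ h (unit φ γ) = ψ γ := by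
  change preLift c τ ψ (formalConj 1 γ) = ψ γ
  simp [preLift, formalConj]

theorem apply_lift (h : n.comp ψ = τ.comp φ) (x : FreeNormalClosure φ) :
    n (lift c τ ψ h x) = τ (boundary φ x) := by
  obtain ⟨x, rfl⟩ := QuotientGroup.mk_surjective x
  exact apply_preLift c τ ψ h x

end Lift

end FreeNormalClosure

section NormalMaps

variable {M G S : Type u} [Group M] [Group G] [Group S] {T : Type*} [Group T]

theorem NormalStructure.ker_le_center {n : M →* G} (c : NormalStructure n) :
    n.ker ≤ Subgroup.center M := by
  intro z hz
  refine Subgroup.mem_center_iff.2 fun x => ?_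
  have h := c.peiffer z x
  rwa [hz, map_one, MulAut.one_apply, eq_mul_inv_iff_mul_eq] at h

theorem isNormalMap_of_surjective {n : M →* G} (hn : Function.Surjective n)
    (hker : n.ker ≤ Subgroup.center M) : IsNormalMap n := by
  have hconj : n.ker ≤ (MulAut.conj (G := M)).ker := fun z hz => MulEquiv.ext fun x => by
    rw [MulAut.conj_apply, ← Subgroup.mem_center_iff.1 (hker hz) x, mul_inv_cancel_right,
      MulAut.one_apply]
  have hact : ∀ m, n.liftOfSurjective hn ⟨MulAut.conj, hconj⟩ (n m) = MulAut.conj m :=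
    fun m => n.liftOfRightInverse_comp_apply _ _ _ m
  refine ⟨⟨n.liftOfSurjective hn ⟨MulAut.conj, hconj⟩, fun g m => ?_, fun m m' => ?_⟩⟩
  · obtain ⟨x, rfl⟩ := hn g
    simp [hact]
  · simp [hact]

theorem isNormalMap_inclusion {H K : Subgroup G} (h : H ≤ K) [(H.subgroupOf K).Normal] :
    IsNormalMap (Subgroup.inclusion h) := by
  let e : H.subgroupOf K ≃* H := Subgroup.subgroupOfEquivOfLe h
  exact ⟨⟨(MulAut.congr e).toMonoidHom.comp MulAut.conjNormal, fun _ _ => rfl, fun _ _ => rfl⟩⟩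

theorem IsNormalMap.isSubnormalMap {n : M →* G} (hn : IsNormalMap n) : IsSubnormalMap n :=
  .comp _ _ .id hn

theorem IsSubnormalMap.of_bijective {n : M →* G} (hn : Function.Bijective n) :
    IsSubnormalMap n :=
  (isNormalMap_of_surjective hn.2
    ((MonoidHom.ker_eq_bot_iff n).2 hn.1 ▸ bot_le)).isSubnormalMap

theorem IsSubnormalMap.trans {m : M →* G} {n : S →* M} (hm : IsSubnormalMap m)
    (hn : IsSubnormalMap n) : IsSubnormalMap (m.comp n) := by
  induction hn with
  | id => exact hm
  | comp p q _ hq ih => exact ih.comp _ q hq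

theorem isSubnormalMap_subtype {H : Subgroup G} (hH : H.IsSubnormal) :
    IsSubnormalMap H.subtype := by
  induction hH with
  | top => exact .of_bijective Subgroup.topEquiv.bijective
  | step H K hHK _ _ ih => exact ih.comp _ (Subgroup.inclusion hHK) (isNormalMap_inclusion hHK)

theorem isNormalMap_lift_of_commutator_le {N : Subgroup M} [N.Normal] {f : M →* G}
    (hf : Function.Surjective f) (hN : N ≤ f.ker) (hcomm : ⁅f.ker, (⊤ : Subgroup M)⁆ ≤ N) :
    IsNormalMap (QuotientGroup.lift N f hN) := by
  refine isNormalMap_of_surjective (QuotientGroup.lift_surjective_of_surjective N f hf hN) ?_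
  rw [QuotientGroup.ker_lift, ← Subgroup.commutator_top_right_eq_bot_iff_le_center,
    ← Subgroup.map_top_of_surjective _ (QuotientGroup.mk'_surjective N),
    ← Subgroup.map_commutator, Subgroup.map_eq_bot_iff, QuotientGroup.ker_mk']
  exact hcomm

theorem isSubnormalMap_of_filtration {K : ℕ → Subgroup M} [∀ i, (K i).Normal]
    (hK : Antitone K) (hcomm : ∀ i, ⁅K i, (⊤ : Subgroup M)⁆ ≤ K (i + 1)) {f : M →* G}
    (hf : Function.Surjective f) (hker : f.ker = K 0) {n : ℕ} (hn : K n = ⊥) :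
    IsSubnormalMap f := by
  induction n generalizing K G with
  | zero => exact .of_bijective ⟨(MonoidHom.ker_eq_bot_iff f).1 (hker.trans hn), hf⟩
  | succ n ih =>
    have hmk : IsSubnormalMap (QuotientGroup.mk' (K 1)) :=
      ih (K := fun i => K (i + 1)) (fun i j hij => hK (Nat.succ_le_succ hij))
        (fun i => hcomm (i + 1)) (QuotientGroup.mk'_surjective _) (QuotientGroup.ker_mk' _) hn
    have hlift : IsNormalMap (QuotientGroup.lift (K 1) f ((hK zero_le_one).trans hker.ge)) :=
      isNormalMap_lift_of_commutator_le hf _ (hker ▸ hcomm 0)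
    exact hlift.isSubnormalMap.trans hmk

theorem NormalStructure.normal_eqLocus {n : M →* G} (c : NormalStructure n) {σ σ' : T →* M}
    (h : n.comp σ = n.comp σ') : (σ.eqLocus σ').Normal := by
  have hcentral : ∀ g y, y * ((σ' g)⁻¹ * σ g) = ((σ' g)⁻¹ * σ g) * y := by
    intro g y
    refine Subgroup.mem_center_iff.1 (c.ker_le_center ?_) y
    have hg : n (σ g) = n (σ' g) := DFunLike.congr_fun h g
    simp [MonoidHom.mem_ker, hg]
  refine ⟨fun x hx g => ?_⟩
  have hx : σ x = σ' x := hx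
  calc σ (g * x * g⁻¹) = σ' g * (((σ' g)⁻¹ * σ g) * σ' x) * (σ g)⁻¹ := by
        simp only [map_mul, map_inv, hx]
        group
    _ = σ' (g * x * g⁻¹) := by
        rw [← hcentral]
        simp only [map_mul, map_inv]
        group

theorem IsSubnormalMap.hom_ext {s : S →* G} (hs : IsSubnormalMap s) {X : Set T}
    (hX : Subgroup.normalClosure X = ⊤) {σ σ' : T →* S} (h : Set.EqOn σ σ' X)
    (hcomp : s.comp σ = s.comp σ') : σ = σ' := by
  induction hs with
  | id => exact hcomp
  | comp m n _ hn ih =>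
    obtain ⟨c⟩ := hn
    have := c.normal_eqLocus (ih (fun x hx => congrArg n (h hx)) hcomp)
    have hle : Subgroup.normalClosure X ≤ σ.eqLocus σ' := Subgroup.normalClosure_le_normal h
    exact MonoidHom.ext fun x => hle (hX ▸ Subgroup.mem_top x)

end NormalMaps

theorem exists_compatible_seq_of_surjective {X : ℕ → Type*} (d : ∀ i, X (i + 1) → X i)
    (hd : ∀ i, Function.Surjective (d i)) (n : ℕ) (a : X n) :
    ∃ x : ∀ i, X i, (∀ i, d i (x (i + 1)) = x i) ∧ x n = a := by
  induction n generalizing X with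
  | zero =>
    choose r hr using hd
    exact ⟨fun i => Nat.rec a (fun i y => r i y) i, fun i => hr i _, rfl⟩
  | succ n ih =>
    obtain ⟨y, hy, rfl⟩ := ih (X := fun i => X (i + 1)) (fun i => d (i + 1)) (fun i => hd (i + 1)) a
    refine ⟨fun i => Nat.casesOn i (d 0 (y 0)) y, ?_, rfl⟩
    rintro (_ | i)
    · rfl
    · exact hy i

namespace NormalClosuresTower

variable {Γ G : Type u} [Group Γ] [Group G] (φ : Γ →* G)

theorem finite_stage [Finite Γ] [Finite G] (i : ℕ) : Finite (stage φ i).carrier := by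
  induction i with
  | zero => assumption
  | succ i ih => exact FreeNormalClosure.finite (stage φ i).hom

theorem down_comp_hom (i : ℕ) : (down φ i).comp (stage φ (i + 1)).hom = (stage φ i).hom :=
  MonoidHom.ext fun γ => FreeNormalClosure.boundary_unit (stage φ i).hom γ

/-- The image in the stage `i` of the stage `i + j`. -/
def image : ℕ → ∀ i, Subgroup (stage φ i).carrier
  | 0, _ => ⊤
  | j + 1, i => (image j (i + 1)).map (down φ i)

theorem image_succ_eq_conjClosure (j i : ℕ) :
    image φ (j + 1) i = conjClosure (image φ j i) (Set.range (stage φ i).hom) := by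
  induction j generalizing i with
  | zero =>
    exact ((MonoidHom.range_eq_map _).symm.trans
      (FreeNormalClosure.range_boundary (stage φ i).hom)).trans (conjClosure_top _).symm
  | succ j ih =>
    change (image φ (j + 1) (i + 1)).map (down φ i) = _
    rw [ih, map_conjClosure, ← Set.range_comp, ← MonoidHom.coe_comp, down_comp_hom]
    rfl

theorem image_antitone (i : ℕ) : Antitone fun j => image φ j i := by
  refine antitone_nat_of_succ_le fun j => ?_
  induction j generalizing i with
  | zero => exact le_top
  | succ j ih => exact Subgroup.map_mono (ih (i + 1))

theorem isSubnormal_image (j i : ℕ) : (image φ j i).IsSubnormal := by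
  induction j with
  | zero => exact .top
  | succ j ih =>
    have hle := image_antitone φ i j.le_succ
    refine .step _ _ hle ih ((Subgroup.normal_subgroupOf_iff_le_normalizer hle).2 ?_)
    change image φ j i ≤ Subgroup.normalizer (image φ (j + 1) i : Set _)
    rw [image_succ_eq_conjClosure]
    exact le_normalizer_conjClosure _ _

/-- The projection of the limit onto the stage `i`. -/
def proj (i : ℕ) : limit φ →* (stage φ i).carrier :=
  (Pi.evalMonoidHom (fun i => (stage φ i).carrier) i).comp (limit φ).subtype

theorem down_comp_proj (i : ℕ) : (down φ i).comp (proj φ (i + 1)) = proj φ i :=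
  MonoidHom.ext fun x => x.2 i

theorem exists_hom_of_isSubnormalMap {S : Type u} [Group S] {s : S →* G}
    (hs : IsSubnormalMap s) (ψ : Γ →* S) (h : s.comp ψ = φ) :
    ∃ (k : ℕ) (τ : (stage φ k).carrier →* S),
      τ.comp (stage φ k).hom = ψ ∧ s.comp (τ.comp (proj φ k)) = fromLimit φ := by
  induction hs with
  | id => exact ⟨0, MonoidHom.id G, h.symm, rfl⟩
  | @comp M N _ _ m n _ hn ih =>
    obtain ⟨k, τ, hτ, hproj⟩ := ih (n.comp ψ) h
    obtain ⟨c⟩ := hn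
    refine ⟨k + 1, FreeNormalClosure.lift c τ ψ hτ.symm, ?_, ?_⟩
    · exact MonoidHom.ext (FreeNormalClosure.lift_unit c τ ψ hτ.symm)
    · refine MonoidHom.ext fun x => (congrArg m ?_).trans (DFunLike.congr_fun hproj x)
      exact (FreeNormalClosure.apply_lift c τ ψ hτ.symm _).trans (congrArg τ (x.2 k))

theorem ker_proj_antitone : Antitone fun i => (proj φ i).ker :=
  antitone_nat_of_succ_le fun i => by
    rw [← down_comp_proj φ i, ← MonoidHom.comap_ker]
    exact Subgroup.ker_le_comap _ _

theorem commutator_ker_proj_le (i : ℕ) :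
    ⁅(proj φ i).ker, (⊤ : Subgroup (limit φ))⁆ ≤ (proj φ (i + 1)).ker := by
  refine Subgroup.commutator_le.2 fun x hx y _ => ?_
  have hker : proj φ (i + 1) x ∈ (down φ i).ker := by
    rwa [← Subgroup.mem_comap, MonoidHom.comap_ker, down_comp_proj]
  have hcenter := FreeNormalClosure.ker_boundary_le_center _ hker
  rw [MonoidHom.mem_ker, map_commutatorElement, commutatorElement_eq_one_iff_commute]
  exact ((Subgroup.mem_center_iff.1 hcenter) _).symm

theorem iInf_ker_proj : ⨅ i, (proj φ i).ker = ⊥ := by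
  refine (Subgroup.eq_bot_iff_forall _).2 fun x hx => Subtype.ext (funext fun i => ?_)
  exact Subgroup.mem_iInf.1 hx i

theorem range_proj_le_image (j i : ℕ) : (proj φ i).range ≤ image φ j i := by
  induction j generalizing i with
  | zero => exact le_top
  | succ j ih =>
    rw [← down_comp_proj, MonoidHom.range_comp]
    exact Subgroup.map_mono (ih (i + 1))

section Finite

variable [Finite Γ] [Finite G]

theorem exists_image_le (i : ℕ) : ∃ n, ∀ j, image φ n i ≤ image φ j i := by
  have := finite_stage φ i
  exact exists_forall_le_of_index_le (image_antitone φ i) fun j =>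
    Nat.le_of_dvd Nat.card_pos (Subgroup.index_dvd_card _)

theorem map_down_iInf_image (i : ℕ) :
    (⨅ j, image φ j (i + 1)).map (down φ i) = ⨅ j, image φ j i := by
  refine le_antisymm (le_iInf fun j => ?_) ?_
  · exact (Subgroup.map_mono (iInf_le _ j)).trans (image_antitone φ i j.le_succ)
  · obtain ⟨n, hn⟩ := exists_image_le φ (i + 1)
    exact (iInf_le _ (n + 1)).trans (Subgroup.map_mono (le_iInf hn))

theorem range_proj (i : ℕ) : (proj φ i).range = ⨅ j, image φ j i := by
  refine le_antisymm (le_iInf fun j => range_proj_le_image φ j i) fun a ha => ?_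
  obtain ⟨x, hx, hxa⟩ := exists_compatible_seq_of_surjective (X := fun i => ↥(⨅ j, image φ j i))
    (fun i x => ⟨down φ i x, map_down_iInf_image φ i ▸ Subgroup.mem_map_of_mem _ x.2⟩)
    (fun i y => by
      obtain ⟨x, hx, hxy⟩ := (map_down_iInf_image φ i).ge y.2
      exact ⟨⟨x, hx⟩, Subtype.ext hxy⟩) i ⟨a, ha⟩
  exact ⟨⟨fun i => x i, fun i => congrArg Subtype.val (hx i)⟩, congrArg Subtype.val hxa⟩

theorem exists_range_proj_eq_image (i : ℕ) :
    ∃ n, ∀ j, n ≤ j → (proj φ i).range = image φ j i := by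
  obtain ⟨n, hn⟩ := exists_image_le φ i
  refine ⟨n, fun j hj => (range_proj φ i).trans (le_antisymm (iInf_le _ j) (le_iInf fun k => ?_))⟩
  exact (image_antitone φ i hj).trans (hn k)

theorem map_normalClosure_range_toLimit (i : ℕ) :
    (Subgroup.normalClosure (Set.range (toLimit φ))).map (proj φ i) = (proj φ i).range := by
  obtain ⟨n, hn⟩ := exists_range_proj_eq_image φ i
  rw [← conjClosure_top, map_conjClosure, ← MonoidHom.range_eq_map, ← Set.range_comp]
  conv_rhs => rw [hn (n + 1) n.le_succ, image_succ_eq_conjClosure, ← hn n le_rfl]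
  rfl

theorem exists_ker_proj_eq_bot : ∃ n, (proj φ n).ker = ⊥ := by
  have := finite_stage φ
  have : Finite (toLimit φ).range := .of_surjective _ (toLimit φ).rangeRestrict_surjective
  have hsup : ∀ i, Subgroup.normalClosure ((toLimit φ).range : Set (limit φ)) ⊔
      (proj φ i).ker = ⊤ := fun i => by
    rw [MonoidHom.coe_range, ← Subgroup.comap_map_eq, map_normalClosure_range_toLimit,
      MonoidHom.range_eq_map, Subgroup.comap_map_eq, top_sup_eq]
  obtain ⟨n, hn⟩ := exists_forall_le_of_normalClosure_sup_eq_top (ker_proj_antitone φ)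
    (commutator_ker_proj_le φ) hsup
  exact ⟨n, le_bot_iff.1 ((le_iInf hn).trans_eq (iInf_ker_proj φ))⟩

theorem normalClosure_range_toLimit :
    Subgroup.normalClosure (Set.range (toLimit φ)) = ⊤ := by
  obtain ⟨n, hn⟩ := exists_ker_proj_eq_bot φ
  refine Subgroup.map_injective ((MonoidHom.ker_eq_bot_iff _).1 hn) ?_
  rw [map_normalClosure_range_toLimit, MonoidHom.range_eq_map]

theorem isSubnormalMap_fromLimit : IsSubnormalMap (fromLimit φ) := by
  obtain ⟨n, hn⟩ := exists_ker_proj_eq_bot φ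
  obtain ⟨j, hj⟩ := exists_range_proj_eq_image φ 0
  have hrange : (proj φ 0).range.IsSubnormal := hj j le_rfl ▸ isSubnormal_image φ j 0
  exact (isSubnormalMap_subtype hrange).trans
    (isSubnormalMap_of_filtration (ker_proj_antitone φ) (commutator_ker_proj_le φ)
      (proj φ 0).rangeRestrict_surjective (proj φ 0).ker_rangeRestrict hn)

end Finite

end NormalClosuresTower

/-- For finite `Γ` and `G`, `Γ → Γ_∞ → G` is initial among the factorizations of `φ : Γ →* G`
whose second map is subnormal: it is such a factorization, and it maps uniquely to every such
factorization `Γ → S → G`. -/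
theorem mainTheorem2 {Γ G : Type u} [Group Γ] [Group G] [Finite Γ] [Finite G] (φ : Γ →* G) :
    ((NormalClosuresTower.fromLimit φ).comp (NormalClosuresTower.toLimit φ) = φ ∧
      IsSubnormalMap (NormalClosuresTower.fromLimit φ)) ∧
    ∀ (S : Type u) [Group S] (ψ : Γ →* S) (s : S →* G),
      s.comp ψ = φ → IsSubnormalMap s →
        ∃! σ : NormalClosuresTower.limit φ →* S,
          σ.comp (NormalClosuresTower.toLimit φ) = ψ ∧
            s.comp σ = NormalClosuresTower.fromLimit φ := by
  refine ⟨⟨rfl, NormalClosuresTower.isSubnormalMap_fromLimit φ⟩, fun S _ ψ s hψ hs => ?_⟩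
  obtain ⟨k, τ, hτ, hsτ⟩ := NormalClosuresTower.exists_hom_of_isSubnormalMap φ hs ψ hψ
  refine ⟨τ.comp (NormalClosuresTower.proj φ k), ⟨hτ, hsτ⟩, ?_⟩
  rintro σ ⟨hσ, hsσ⟩
  refine hs.hom_ext (NormalClosuresTower.normalClosure_range_toLimit φ) ?_ (hsσ.trans hsτ.symm)
  rintro _ ⟨γ, rfl⟩
  exact (DFunLike.congr_fun hσ γ).trans (DFunLike.congr_fun hτ γ).symm
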